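/- Consider the formal model of the AODV routing protocol in the process algebra AWN. Every node $ip$ runs two sequential processes, $\mathrm{AODV}$ (message handling) and $\mathrm{QMSG}$ (a FIFO queue of received messages, always able to receive, which feeds $\mathrm{AODV}$). $\mathrm{AODV}$ maintains the node's own address, its own sequence number, the request identifiers already seen, the queued data packets, and a routing table $rt$. A routing table is a set of entries $(dip,dsn,dsk,flag,hops,nhip,pre)$ (destination, sequence number, known/unknown status of that number, validity flag $\mathsf{val}$ or $\mathsf{inval}$, hop count, next hop, precursors) with at most one entry per destination; $\mathrm{kD}(rt)$ is the set of destinations having an entry, and $\mathrm{sqn}(rt,dip)$, $\mathrm{dhops}(rt,dip)$, $\mathrm{status}(rt,dip)$ are the sequence number, hop count and validity flag of the entry for $dip$. $\mathrm{AODV}$ handles data packets, route requests, route replies and route errors as AODV prescribes. In particular, a route reply $\mathrm{rrep}(hops,dip,dsn,oip,sip)$ (a reply to a request by $oip$ for a route to $dip$, sent by the neighbour $sip$, which is $hops$ hops away from $dip$) is sent only (a) by the destination $dip$ of a route request, with hop count $0$ and its own sequence number; (b) by an intermediate node that has a valid entry for $dip$ with a known, sufficiently fresh sequence number, with the data of that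 entry; (c) by a node that received $\mathrm{rrep}(hops,dip,dsn,oip,sip)$, is not $oip$, has a valid route to $oip$, and whose routing table was changed by updating it with $(dip,dsn,\mathsf{kno},\mathsf{val},hops+1,sip,\emptyset)$; it forwards the reply with hop count $hops+1$. A network expression is an encapsulated parallel composition of finitely many nodes with distinct addresses, each with a transmission range that may change at any time (the ranges changing independently of each other, or symmetrically). Initially all routing tables, sets of seen requests, packet stores and message queues are empty and all own sequence numbers are $1$. A network expression is reachable if it arises from an initial one by finitely many transitions of the operational semantics of AWN. A transition $N\xrightarrow{R:\mathbf{*cast}(m)}N'$ means that some node of $N$ sends (unicasts, groupcasts or broadcasts) the message $m$, which is received by the nodes in $R$. Let $\xi_N^{ip}(rt)$ be the routing table that node $ip$ maintains in $N$. **Proposition.** Let $N$ be a reachable network expression and suppose that $$N\xrightarrow{R:\mathbf{*cast}(\mathrm{rrep}(hops_c,\,dip_c,\,dsn_c,\,oip_c,\,ip_c))}N'$$ for some $R$, $N'$ and $oip_c$, where the sender $ip_c$ is different from the destination $dip_c$ of the route. Then $ip_c$ is a node of $N$, and $$dip_c\in\mathrm{kD}(\xi_N^{ip_c}(rt)),\quad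 \mathrm{sqn}(\xi_N^{ip_c}(rt),dip_c)=dsn_c,\quad \mathrm{dhops}(\xi_N^{ip_c}(rt),dip_c)=hops_c,\quad \mathrm{status}(\xi_N^{ip_c}(rt),dip_c)=\mathsf{val}.$$ -/

import Mathlib

namespace AWN

/-! ## Data structure -/

/-- Sequence-number-status flag: is the sequence number of an entry known to be up to date? -/
inductive SeqStatus
  | kno | unk
  deriving DecidableEq

/-- Route validity. -/
inductive Flag
  | val | inval
  deriving DecidableEq

/-- Pending-request flag of a queue of data packets. -/
inductive Pending
  | pen | nonpen
  deriving DecidableEq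

/-- The components `(dsn, dsk, flag, hops, nhip, pre)` of a routing table entry
`(dip, dsn, dsk, flag, hops, nhip, pre)`. Sequence numbers are natural numbers, `0` standing for
"unknown". -/
structure Entry (IP : Type) where
  dsn : ℕ
  dsk : SeqStatus
  flag : Flag
  hops : ℕ
  nhip : IP
  pre : Set IP

/-- Routing tables: sets of entries with at most one entry for each destination `dip`, that is,
partial functions on destinations. `(dip, dsn, dsk, flag, hops, nhip, pre) ∈ rt` reads
`rt dip = some ⟨dsn, dsk, flag, hops, nhip, pre⟩`. -/
abbrev RT (IP : Type) := IP → Option (Entry IP)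

/-- Stores of queued data packets: for each destination at most one queue, with its
pending-request flag. -/
abbrev Queues (IP DATA : Type) := IP → Option (Pending × List DATA)

/-- Messages. -/
inductive Msg (IP DATA : Type)
  | newpkt (d : DATA) (dip : IP)
  | pkt (d : DATA) (dip oip : IP)
  | rreq (hops rreqid : ℕ) (dip : IP) (dsn : ℕ) (dsk : SeqStatus) (oip : IP) (osn : ℕ) (sip : IP)
  | rrep (hops : ℕ) (dip : IP) (dsn : ℕ) (oip sip : IP)
  | rerr (dests : IP → Option ℕ) (sip : IP)

section Operators

variable {IP DATA : Type}

/-- Increment of a sequence number; the unknown sequence number stays unknown. -/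
def inc (n : ℕ) : ℕ := if n = 0 then 0 else n + 1

/-- Sequence number of the route to `dip`; `0` if there is no entry. -/
def sqn (rt : RT IP) (dip : IP) : ℕ :=
  match rt dip with
  | some s => s.dsn
  | none => 0

/-- Sequence-number-status flag of the route to `dip`; unknown if there is no entry. -/
def sqnf (rt : RT IP) (dip : IP) : SeqStatus :=
  match rt dip with
  | some s => s.dsk
  | none => .unk

/-- Validity of the route to `dip` (partial). -/
def status (rt : RT IP) (dip : IP) : Option Flag := (rt dip).map Entry.flag

/-- Hop count of the route to `dip` (partial). -/
def dhops (rt : RT IP) (dip : IP) : Option ℕ := (rt dip).map Entry.hops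

/-- Next hop of the route to `dip` (partial). -/
def nhop (rt : RT IP) (dip : IP) : Option IP := (rt dip).map Entry.nhip

/-- Precursors of the route to `dip` (partial). -/
def precs (rt : RT IP) (dip : IP) : Option (Set IP) := (rt dip).map Entry.pre

/-- Known destinations. -/
def kD (rt : RT IP) : Set IP := {dip | ∃ s, rt dip = some s}

/-- Known destinations with a valid entry. -/
def akD (rt : RT IP) : Set IP := {dip | ∃ s, rt dip = some s ∧ s.flag = .val}

/-- Known destinations with an invalid entry. -/
def ikD (rt : RT IP) : Set IP := {dip | ∃ s, rt dip = some s ∧ s.flag = .inval}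

/-- Adds precursors to an entry. -/
def Entry.addPre (s : Entry IP) (npre : Set IP) : Entry IP := { s with pre := s.pre ∪ npre }

open Classical in
/-- Adds precursors to the entry for `dip` (defined only if there is one). -/
noncomputable def addprecRT (rt : RT IP) (dip : IP) (npre : Set IP) : Option (RT IP) :=
  (rt dip).map fun s => fun d => if d = dip then some (s.addPre npre) else rt d

open Classical in
/-- Updates `rt` with the entry `(dip, r)`. The entry is added if there is none for `dip`. It
overwrites the existing entry `s` if its sequence number is larger, or if the sequence numbers are
equal and `s` is invalid or has a larger hop count. Otherwise, an entry whose sequence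
number is unknown (these describe the link to a neighbour a message was just received from) is
recorded with the sequence number of `s`; in the remaining case `s` stays. Precursors are never
lost. -/
noncomputable def update (rt : RT IP) (dip : IP) (r : Entry IP) : RT IP := fun d =>
  if d = dip then
    match rt dip with
    | none => some r
    | some s =>
      if s.dsn < r.dsn ∨ (s.dsn = r.dsn ∧ (s.flag = .inval ∨ r.hops < s.hops)) then
        some (r.addPre s.pre)
      else if r.dsk = .unk then
        some { r.addPre s.pre with dsn := s.dsn }
      else
        some (s.addPre r.pre)
  else rt d

/-- Invalidates the routes to the destinations in `dests`, with their new sequence numbers. -/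
def invalidate (rt : RT IP) (dests : IP → Option ℕ) : RT IP := fun d =>
  match rt d, dests d with
  | some s, some rsn => some { s with dsn := rsn, flag := .inval }
  | s, _ => s

open Classical in
/-- The valid routes with next hop `nh`, with their sequence numbers incremented:
`{(rip, inc(sqn(rt, rip))) | rip ∈ akD(rt) ∧ nhop(rt, rip) = nh}`. -/
noncomputable def brokenDests (rt : RT IP) (nh : IP) : IP → Option ℕ := fun rip =>
  if rip ∈ akD rt ∧ nhop rt rip = some nh then some (inc (sqn rt rip)) else none

/-- `⋃ {precs(rt, rip) | (rip, *) ∈ dests}`. -/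
def allPrecs (rt : RT IP) (dests : IP → Option ℕ) : Set IP :=
  {x | ∃ rip rsn s, dests rip = some rsn ∧ precs rt rip = some s ∧ x ∈ s}

open Classical in
/-- `{(rip, rsn) | (rip, rsn) ∈ dests ∧ precs(rt, rip) ≠ ∅}`. -/
noncomputable def destsWithPrecs (rt : RT IP) (dests : IP → Option ℕ) : IP → Option ℕ := fun rip =>
  if ∃ x s, precs rt rip = some s ∧ x ∈ s then dests rip else none

open Classical in
/-- The part of a received set `dests` that concerns `rt`: valid routes whose next hop is the
sender `sip` of the error message and whose sequence number is smaller than the received one. -/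
noncomputable def relevantDests (rt : RT IP) (sip : IP) (dests : IP → Option ℕ) :
    IP → Option ℕ := fun rip =>
  match dests rip with
  | some rsn =>
    if rip ∈ akD rt ∧ nhop rt rip = some sip ∧ sqn rt rip < rsn then some rsn else none
  | none => none

open Classical in
/-- The partial function defined only at `dip`, with value `n`. -/
noncomputable def singleDest (dip : IP) (n : ℕ) : IP → Option ℕ := fun d =>
  if d = dip then some n else none

/-- A fresh request identifier for requests originated by `ip`. -/
noncomputable def nrreqid (rreqs : Set (IP × ℕ)) (ip : IP) : ℕ := sSup {n | (ip, n) ∈ rreqs} + 1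

/-- Destinations of queued packets. -/
def qD (q : Queues IP DATA) : Set IP := {dip | ∃ s, q dip = some s}

open Classical in
/-- Appends a data packet to the queue for `dip`. -/
noncomputable def addQueue (d : DATA) (dip : IP) (q : Queues IP DATA) : Queues IP DATA := fun x =>
  if x = dip then
    match q dip with
    | none => some (.nonpen, [d])
    | some (p, l) => some (p, l ++ [d])
  else q x

/-- First data packet of the queue for `dip` (partial). -/
def headQueue (q : Queues IP DATA) (dip : IP) : Option DATA := (q dip).bind fun s => s.2.head?

open Classical in
/-- Removes the first data packet of the queue for `dip`, and the queue if it becomes empty. -/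
noncomputable def dropQueue (dip : IP) (q : Queues IP DATA) : Queues IP DATA := fun x =>
  if x = dip then
    match q dip with
    | some (p, _ :: d :: l) => some (p, d :: l)
    | _ => none
  else q x

open Classical in
/-- Sets the pending-request flag of the queue for `dip` (if there is one). -/
noncomputable def setP (q : Queues IP DATA) (dip : IP) (p : Pending) : Queues IP DATA := fun x =>
  if x = dip then (q dip).map fun s => (p, s.2) else q x

end Operators

/-! ## Sequential processes -/

/-- Data variables. -/
inductive Var
  | ip | dip | oip | sip | sn | dsn | osn | dsk | hops | rt | rreqid | rreqs | queues | data
  | msg | msgs | pre | dests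
  deriving DecidableEq

/-- Type of a data variable. -/
abbrev Var.Ty (IP DATA : Type) : Var → Type
  | .ip => IP
  | .dip => IP
  | .oip => IP
  | .sip => IP
  | .sn => ℕ
  | .dsn => ℕ
  | .osn => ℕ
  | .dsk => SeqStatus
  | .hops => ℕ
  | .rt => RT IP
  | .rreqid => ℕ
  | .rreqs => Set (IP × ℕ)
  | .queues => Queues IP DATA
  | .data => DATA
  | .msg => Msg IP DATA
  | .msgs => List (Msg IP DATA)
  | .pre => Set IP
  | .dests => IP → Option ℕ

/-- Valuations: partial, type-respecting assignments of values to variables. -/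
abbrev Valuation (IP DATA : Type) := (v : Var) → Option (v.Ty IP DATA)

/-- Data expressions, given by their (partial) evaluation. -/
abbrev Exp (IP DATA α : Type) := Valuation IP DATA → Option α

/-- Data formulas, given by their free variables and their truth under a valuation. -/
structure Formula (IP DATA : Type) where
  fv : Set Var
  holds : Valuation IP DATA → Prop

/-- Process names. -/
inductive PName
  | AODV | PKT | RREQ | RREP | RERR | QMSG
  deriving DecidableEq

/-- Sequential process expressions. A call `X(exp₁,…,expₙ)` gives the expression for each
parameter of `X` by the name of the parameter (values of `args` at other variables are ignored).
`msg` is the only variable of message type, so `receive(msg).p` is `receive p`. -/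
inductive SP (IP DATA : Type)
  | call (X : PName) (args : (v : Var) → Exp IP DATA (v.Ty IP DATA))
  | guard (φ : Formula IP DATA) (p : SP IP DATA)
  | assign (v : Var) (e : Exp IP DATA (v.Ty IP DATA)) (p : SP IP DATA)
  | choice (p q : SP IP DATA)
  | broadcast (ms : Exp IP DATA (Msg IP DATA)) (p : SP IP DATA)
  | groupcast (dests : Exp IP DATA (Set IP)) (ms : Exp IP DATA (Msg IP DATA)) (p : SP IP DATA)
  | unicast (dest : Exp IP DATA IP) (ms : Exp IP DATA (Msg IP DATA)) (p q : SP IP DATA)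
  | send (ms : Exp IP DATA (Msg IP DATA)) (p : SP IP DATA)
  | deliver (data : Exp IP DATA DATA) (p : SP IP DATA)
  | receive (p : SP IP DATA)

/-- Actions of processes. -/
inductive Act (IP DATA : Type)
  | broadcast (m : Msg IP DATA)
  | groupcast (D : Set IP) (m : Msg IP DATA)
  | unicast (dip : IP) (m : Msg IP DATA)
  | notUnicast (dip : IP)
  | send (m : Msg IP DATA)
  | deliver (d : DATA)
  | receive (m : Msg IP DATA)
  | tau

/-- `Extends φ ξ ξ'`: the valuation `ξ'` agrees with `ξ` on all variables on which `ξ` is defined,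
evaluates in addition exactly the other free variables of `φ`, and satisfies `φ`. -/
def Extends {IP DATA : Type} (φ : Formula IP DATA) (ξ ξ' : Valuation IP DATA) : Prop :=
  (∀ v, ξ v ≠ none → ξ' v = ξ v) ∧ (∀ v, ξ v = none → (ξ' v ≠ none ↔ v ∈ φ.fv)) ∧ φ.holds ξ'

/-! ## The AODV processes -/

/-- Parameters of the process names. -/
def PName.params : PName → List Var
  | .AODV => [.ip, .sn, .rt, .rreqs, .queues]
  | .PKT => [.data, .dip, .oip, .ip, .sn, .rt, .rreqs, .queues]
  | .RREQ => [.hops, .rreqid, .dip, .dsn, .dsk, .oip, .osn, .sip, .ip, .sn, .rt, .rreqs, .queues]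
  | .RREP => [.hops, .dip, .dsn, .oip, .sip, .ip, .sn, .rt, .rreqs, .queues]
  | .RERR => [.dests, .sip, .ip, .sn, .rt, .rreqs, .queues]
  | .QMSG => [.msgs]

section Processes

variable (IP DATA : Type)

/-- `X(var₁,…,varₙ)`: the call that passes on the current values of the parameters. -/
def callSame (X : PName) : SP IP DATA := .call X fun v ξ => ξ v

variable {IP DATA} in
/-- Error handling after a failed unicast to the next hop towards the value of `x`. All valid
routes that use the broken link are invalidated, and the precursors are informed. -/
noncomputable def linkBreak (x : Exp IP DATA IP) : SP IP DATA :=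
  .assign .dests (fun ξ => do
    let rt : RT IP ← ξ .rt
    let d ← x ξ
    let nh ← nhop rt d
    some (brokenDests rt nh)) <|
  .assign .rt (fun ξ => do
    let rt : RT IP ← ξ .rt
    let ds : IP → Option ℕ ← ξ .dests
    some (invalidate rt ds)) <|
  .assign .pre (fun ξ => do
    let rt : RT IP ← ξ .rt
    let ds : IP → Option ℕ ← ξ .dests
    some (allPrecs rt ds)) <|
  .assign .dests (fun ξ => do
    let rt : RT IP ← ξ .rt
    let ds : IP → Option ℕ ← ξ .dests
    some (destsWithPrecs rt ds)) <|
  .groupcast (fun ξ => ξ .pre) (fun ξ => do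
    let ds : IP → Option ℕ ← ξ .dests
    let ip : IP ← ξ .ip
    some (.rerr ds ip)) <|
  callSame IP DATA .AODV

variable {IP DATA} in
/-- `⟦rt := update(rt, (sip, 0, unk, val, 1, sip, ∅))⟧ p`: records the link to the neighbour from
which a message was received. -/
noncomputable def updateNeighbour (p : SP IP DATA) : SP IP DATA :=
  .assign .rt (fun ξ => do
    let rt : RT IP ← ξ .rt
    let sip : IP ← ξ .sip
    some (update rt sip ⟨0, .unk, .val, 1, sip, ∅⟩)) p

/-- The main process: it receives messages from the message queue and dispatches them; it sends
queued packets for which there is a valid route; it initiates route requests. -/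
noncomputable def bodyAODV : SP IP DATA :=
  .choice
    (.receive <|
      .choice
        (.guard ⟨{.msg, .data, .dip}, fun ξ => ∃ d dip,
            ξ .data = some d ∧ ξ .dip = some dip ∧ ξ .msg = some (.newpkt d dip)⟩ <|
          -- a new packet is a packet that originates here
          .call .PKT fun v => match v with
            | .oip => fun ξ => ξ .ip
            | v => fun ξ => ξ v) <|
      .choice
        (.guard ⟨{.msg, .data, .dip, .oip}, fun ξ => ∃ d dip oip,
            ξ .data = some d ∧ ξ .dip = some dip ∧ ξ .oip = some oip ∧
            ξ .msg = some (.pkt d dip oip)⟩ <|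
          callSame IP DATA .PKT) <|
      .choice
        (.guard ⟨{.msg, .hops, .rreqid, .dip, .dsn, .dsk, .oip, .osn, .sip}, fun ξ =>
            ∃ hops rreqid dip dsn dsk oip osn sip,
            ξ .hops = some hops ∧ ξ .rreqid = some rreqid ∧ ξ .dip = some dip ∧
            ξ .dsn = some dsn ∧ ξ .dsk = some dsk ∧ ξ .oip = some oip ∧ ξ .osn = some osn ∧
            ξ .sip = some sip ∧ ξ .msg = some (.rreq hops rreqid dip dsn dsk oip osn sip)⟩ <|
          updateNeighbour <| callSame IP DATA .RREQ) <|
      .choice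
        (.guard ⟨{.msg, .hops, .dip, .dsn, .oip, .sip}, fun ξ => ∃ hops dip dsn oip sip,
            ξ .hops = some hops ∧ ξ .dip = some dip ∧ ξ .dsn = some dsn ∧ ξ .oip = some oip ∧
            ξ .sip = some sip ∧ ξ .msg = some (.rrep hops dip dsn oip sip)⟩ <|
          updateNeighbour <| callSame IP DATA .RREP)
        (.guard ⟨{.msg, .dests, .sip}, fun ξ => ∃ ds sip,
            ξ .dests = some ds ∧ ξ .sip = some sip ∧ ξ .msg = some (.rerr ds sip)⟩ <|
          updateNeighbour <| callSame IP DATA .RERR)) <|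
  .choice
    -- send a queued packet
    (.guard ⟨{.dip, .queues, .rt}, fun ξ => ∃ dip q rt,
        ξ .dip = some dip ∧ ξ .queues = some q ∧ ξ .rt = some rt ∧ dip ∈ qD q ∩ akD rt⟩ <|
      .assign .data (fun ξ => do
        let q : Queues IP DATA ← ξ .queues
        let dip : IP ← ξ .dip
        headQueue q dip) <|
      .unicast
        (fun ξ => do
          let rt : RT IP ← ξ .rt
          let dip : IP ← ξ .dip
          nhop rt dip)
        (fun ξ => do
          let d : DATA ← ξ .data
          let dip : IP ← ξ .dip
          let ip : IP ← ξ .ip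
          some (.pkt d dip ip))
        (.assign .queues (fun ξ => do
            let q : Queues IP DATA ← ξ .queues
            let dip : IP ← ξ .dip
            some (dropQueue dip q)) <|
          callSame IP DATA .AODV)
        (linkBreak fun ξ => ξ .dip))
    -- initiate a route discovery
    (.guard ⟨{.dip, .queues, .rt}, fun ξ => ∃ dip q rt l,
        ξ .dip = some dip ∧ ξ .queues = some q ∧ ξ .rt = some rt ∧
        q dip = some (.nonpen, l) ∧ dip ∉ akD rt⟩ <|
      .assign .queues (fun ξ => do
        let q : Queues IP DATA ← ξ .queues
        let dip : IP ← ξ .dip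
        some (setP q dip .pen)) <|
      .assign .sn (fun ξ => do
        let sn : ℕ ← ξ .sn
        some (inc sn)) <|
      .assign .rreqid (fun ξ => do
        let rreqs : Set (IP × ℕ) ← ξ .rreqs
        let ip : IP ← ξ .ip
        some (nrreqid rreqs ip)) <|
      .assign .rreqs (fun ξ => do
        let rreqs : Set (IP × ℕ) ← ξ .rreqs
        let ip : IP ← ξ .ip
        let rreqid : ℕ ← ξ .rreqid
        some (rreqs ∪ {(ip, rreqid)})) <|
      .broadcast (fun ξ => do
        let rreqid : ℕ ← ξ .rreqid
        let dip : IP ← ξ .dip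
        let rt : RT IP ← ξ .rt
        let ip : IP ← ξ .ip
        let sn : ℕ ← ξ .sn
        some (.rreq 0 rreqid dip (sqn rt dip) (sqnf rt dip) ip sn ip)) <|
      callSame IP DATA .AODV)

/-- Data packet handling. -/
noncomputable def bodyPKT : SP IP DATA :=
  .choice
    (.guard ⟨{.dip, .ip}, fun ξ => ∃ dip ip, ξ .dip = some dip ∧ ξ .ip = some ip ∧ dip = ip⟩ <|
      .deliver (fun ξ => ξ .data) <|
      callSame IP DATA .AODV)
    (.guard ⟨{.dip, .ip}, fun ξ => ∃ dip ip, ξ .dip = some dip ∧ ξ .ip = some ip ∧ dip ≠ ip⟩ <|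
      .choice
        (.guard ⟨{.dip, .rt}, fun ξ => ∃ dip rt,
            ξ .dip = some dip ∧ ξ .rt = some rt ∧ dip ∈ akD rt⟩ <|
          .unicast
            (fun ξ => do
              let rt : RT IP ← ξ .rt
              let dip : IP ← ξ .dip
              nhop rt dip)
            (fun ξ => do
              let d : DATA ← ξ .data
              let dip : IP ← ξ .dip
              let oip : IP ← ξ .oip
              some (.pkt d dip oip))
            (callSame IP DATA .AODV)
            (linkBreak fun ξ => ξ .dip))
        (.guard ⟨{.dip, .rt}, fun ξ => ∃ dip rt,
            ξ .dip = some dip ∧ ξ .rt = some rt ∧ dip ∉ akD rt⟩ <|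
          .choice
            (.guard ⟨{.oip, .ip}, fun ξ => ∃ oip ip,
                ξ .oip = some oip ∧ ξ .ip = some ip ∧ oip = ip⟩ <|
              .assign .queues (fun ξ => do
                let d : DATA ← ξ .data
                let dip : IP ← ξ .dip
                let q : Queues IP DATA ← ξ .queues
                some (addQueue d dip q)) <|
              callSame IP DATA .AODV)
            (.guard ⟨{.oip, .ip}, fun ξ => ∃ oip ip,
                ξ .oip = some oip ∧ ξ .ip = some ip ∧ oip ≠ ip⟩ <|
              .choice
                (.guard ⟨{.dip, .rt}, fun ξ => ∃ dip rt,
                    ξ .dip = some dip ∧ ξ .rt = some rt ∧ dip ∈ ikD rt⟩ <|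
                  .groupcast
                    (fun ξ => do
                      let rt : RT IP ← ξ .rt
                      let dip : IP ← ξ .dip
                      precs rt dip)
                    (fun ξ => do
                      let rt : RT IP ← ξ .rt
                      let dip : IP ← ξ .dip
                      let ip : IP ← ξ .ip
                      some (.rerr (singleDest dip (sqn rt dip)) ip)) <|
                  callSame IP DATA .AODV)
                (.guard ⟨{.dip, .rt}, fun ξ => ∃ dip rt,
                    ξ .dip = some dip ∧ ξ .rt = some rt ∧ dip ∉ ikD rt⟩ <|
                  callSame IP DATA .AODV))))

/-- Route request handling. -/
noncomputable def bodyRREQ : SP IP DATA :=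
  .choice
    (.guard ⟨{.oip, .rreqid, .rreqs}, fun ξ => ∃ oip rreqid rreqs,
        ξ .oip = some oip ∧ ξ .rreqid = some rreqid ∧ ξ .rreqs = some rreqs ∧
        (oip, rreqid) ∈ rreqs⟩ <|
      callSame IP DATA .AODV)
    (.guard ⟨{.oip, .rreqid, .rreqs}, fun ξ => ∃ oip rreqid rreqs,
        ξ .oip = some oip ∧ ξ .rreqid = some rreqid ∧ ξ .rreqs = some rreqs ∧
        (oip, rreqid) ∉ rreqs⟩ <|
      .assign .rt (fun ξ => do
        let rt : RT IP ← ξ .rt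
        let oip : IP ← ξ .oip
        let osn : ℕ ← ξ .osn
        let hops : ℕ ← ξ .hops
        let sip : IP ← ξ .sip
        some (update rt oip ⟨osn, .kno, .val, hops + 1, sip, ∅⟩)) <|
      .assign .rreqs (fun ξ => do
        let rreqs : Set (IP × ℕ) ← ξ .rreqs
        let oip : IP ← ξ .oip
        let rreqid : ℕ ← ξ .rreqid
        some (rreqs ∪ {(oip, rreqid)})) <|
      .choice
        -- this node is the destination
        (.guard ⟨{.dip, .ip}, fun ξ => ∃ dip ip,
            ξ .dip = some dip ∧ ξ .ip = some ip ∧ dip = ip⟩ <|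
          .assign .sn (fun ξ => do
            let sn : ℕ ← ξ .sn
            let dsn : ℕ ← ξ .dsn
            some (max sn dsn)) <|
          .unicast
            (fun ξ => do
              let rt : RT IP ← ξ .rt
              let oip : IP ← ξ .oip
              nhop rt oip)
            (fun ξ => do
              let dip : IP ← ξ .dip
              let sn : ℕ ← ξ .sn
              let oip : IP ← ξ .oip
              let ip : IP ← ξ .ip
              some (.rrep 0 dip sn oip ip))
            (callSame IP DATA .AODV)
            (linkBreak fun ξ => ξ .oip))
        (.guard ⟨{.dip, .ip}, fun ξ => ∃ dip ip,
            ξ .dip = some dip ∧ ξ .ip = some ip ∧ dip ≠ ip⟩ <|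
          .choice
            -- this node knows a valid route that is fresh enough
            (.guard ⟨{.dip, .dsn, .rt}, fun ξ => ∃ dip dsn rt,
                ξ .dip = some dip ∧ ξ .dsn = some dsn ∧ ξ .rt = some rt ∧
                dip ∈ akD rt ∧ dsn ≤ sqn rt dip ∧ sqnf rt dip = .kno⟩ <|
              .assign .rt (fun ξ => do
                let rt : RT IP ← ξ .rt
                let dip : IP ← ξ .dip
                let sip : IP ← ξ .sip
                addprecRT rt dip {sip}) <|
              .assign .rt (fun ξ => do
                let rt : RT IP ← ξ .rt
                let oip : IP ← ξ .oip
                let dip : IP ← ξ .dip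
                let nh ← nhop rt dip
                addprecRT rt oip {nh}) <|
              .unicast
                (fun ξ => do
                  let rt : RT IP ← ξ .rt
                  let oip : IP ← ξ .oip
                  nhop rt oip)
                (fun ξ => do
                  let rt : RT IP ← ξ .rt
                  let dip : IP ← ξ .dip
                  let h ← dhops rt dip
                  let oip : IP ← ξ .oip
                  let ip : IP ← ξ .ip
                  some (.rrep h dip (sqn rt dip) oip ip))
                (callSame IP DATA .AODV)
                (linkBreak fun ξ => ξ .oip))
            -- no such route: forward the request
            (.guard ⟨{.dip, .dsn, .rt}, fun ξ => ∃ dip dsn rt,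
                ξ .dip = some dip ∧ ξ .dsn = some dsn ∧ ξ .rt = some rt ∧
                (dip ∉ akD rt ∨ sqn rt dip < dsn ∨ sqnf rt dip = .unk)⟩ <|
              .broadcast (fun ξ => do
                let hops : ℕ ← ξ .hops
                let rreqid : ℕ ← ξ .rreqid
                let dip : IP ← ξ .dip
                let rt : RT IP ← ξ .rt
                let dsn : ℕ ← ξ .dsn
                let dsk : SeqStatus ← ξ .dsk
                let oip : IP ← ξ .oip
                let osn : ℕ ← ξ .osn
                let ip : IP ← ξ .ip
                some (.rreq (hops + 1) rreqid dip (max (sqn rt dip) dsn) dsk oip osn ip)) <|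
              callSame IP DATA .AODV)))

/-- Route reply handling. -/
noncomputable def bodyRREP : SP IP DATA :=
  .choice
    -- the routing table has to be updated
    (.guard ⟨{.rt, .dip, .dsn, .hops, .sip}, fun ξ => ∃ rt dip dsn hops sip,
        ξ .rt = some rt ∧ ξ .dip = some dip ∧ ξ .dsn = some dsn ∧ ξ .hops = some hops ∧
        ξ .sip = some sip ∧ rt ≠ update rt dip ⟨dsn, .kno, .val, hops + 1, sip, ∅⟩⟩ <|
      .assign .rt (fun ξ => do
        let rt : RT IP ← ξ .rt
        let dip : IP ← ξ .dip
        let dsn : ℕ ← ξ .dsn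
        let hops : ℕ ← ξ .hops
        let sip : IP ← ξ .sip
        some (update rt dip ⟨dsn, .kno, .val, hops + 1, sip, ∅⟩)) <|
      .choice
        -- this node is the originator of the request
        (.guard ⟨{.oip, .ip}, fun ξ => ∃ oip ip,
            ξ .oip = some oip ∧ ξ .ip = some ip ∧ oip = ip⟩ <|
          .assign .queues (fun ξ => do
            let q : Queues IP DATA ← ξ .queues
            let dip : IP ← ξ .dip
            some (setP q dip .nonpen)) <|
          callSame IP DATA .AODV)
        -- this node is not the originator: forward the reply
        (.guard ⟨{.oip, .ip}, fun ξ => ∃ oip ip,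
            ξ .oip = some oip ∧ ξ .ip = some ip ∧ oip ≠ ip⟩ <|
          .choice
            (.guard ⟨{.oip, .rt}, fun ξ => ∃ oip rt,
                ξ .oip = some oip ∧ ξ .rt = some rt ∧ oip ∈ akD rt⟩ <|
              .assign .rt (fun ξ => do
                let rt : RT IP ← ξ .rt
                let dip : IP ← ξ .dip
                let oip : IP ← ξ .oip
                let nh ← nhop rt oip
                addprecRT rt dip {nh}) <|
              .assign .rt (fun ξ => do
                let rt : RT IP ← ξ .rt
                let dip : IP ← ξ .dip
                let oip : IP ← ξ .oip
                let nd ← nhop rt dip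
                let nh ← nhop rt oip
                addprecRT rt nd {nh}) <|
              .unicast
                (fun ξ => do
                  let rt : RT IP ← ξ .rt
                  let oip : IP ← ξ .oip
                  nhop rt oip)
                (fun ξ => do
                  let hops : ℕ ← ξ .hops
                  let dip : IP ← ξ .dip
                  let dsn : ℕ ← ξ .dsn
                  let oip : IP ← ξ .oip
                  let ip : IP ← ξ .ip
                  some (.rrep (hops + 1) dip dsn oip ip))
                (callSame IP DATA .AODV)
                (linkBreak fun ξ => ξ .oip))
            (.guard ⟨{.oip, .rt}, fun ξ => ∃ oip rt,
                ξ .oip = some oip ∧ ξ .rt = some rt ∧ oip ∉ akD rt⟩ <|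
              callSame IP DATA .AODV)))
    -- the routing table is not updated
    (.guard ⟨{.rt, .dip, .dsn, .hops, .sip}, fun ξ => ∃ rt dip dsn hops sip,
        ξ .rt = some rt ∧ ξ .dip = some dip ∧ ξ .dsn = some dsn ∧ ξ .hops = some hops ∧
        ξ .sip = some sip ∧ rt = update rt dip ⟨dsn, .kno, .val, hops + 1, sip, ∅⟩⟩ <|
      callSame IP DATA .AODV)

/-- Route error handling. -/
noncomputable def bodyRERR : SP IP DATA :=
  .assign .dests (fun ξ => do
    let rt : RT IP ← ξ .rt
    let sip : IP ← ξ .sip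
    let ds : IP → Option ℕ ← ξ .dests
    some (relevantDests rt sip ds)) <|
  .assign .rt (fun ξ => do
    let rt : RT IP ← ξ .rt
    let ds : IP → Option ℕ ← ξ .dests
    some (invalidate rt ds)) <|
  .assign .pre (fun ξ => do
    let rt : RT IP ← ξ .rt
    let ds : IP → Option ℕ ← ξ .dests
    some (allPrecs rt ds)) <|
  .assign .dests (fun ξ => do
    let rt : RT IP ← ξ .rt
    let ds : IP → Option ℕ ← ξ .dests
    some (destsWithPrecs rt ds)) <|
  .groupcast (fun ξ => ξ .pre) (fun ξ => do
    let ds : IP → Option ℕ ← ξ .dests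
    let ip : IP ← ξ .ip
    some (.rerr ds ip)) <|
  callSame IP DATA .AODV

/-- `receive(msg).QMSG(append(msg, msgs))`. -/
def enqueue : SP IP DATA :=
  .receive <| .call .QMSG fun v => match v with
    | .msgs => fun ξ => do
      let l : List (Msg IP DATA) ← ξ .msgs
      let m : Msg IP DATA ← ξ .msg
      some (l ++ [m])
    | v => fun ξ => ξ v

/-- Message queue: always able to receive a message; passes on the first message. -/
def bodyQMSG : SP IP DATA :=
  .choice (enqueue IP DATA) <|
  .guard ⟨{.msgs}, fun ξ => ∃ l, ξ .msgs = some l ∧ l ≠ []⟩ <|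
  .choice
    (.send (fun ξ => do
        let l : List (Msg IP DATA) ← ξ .msgs
        l.head?) <|
      .call .QMSG fun v => match v with
        | .msgs => fun ξ => do
          let l : List (Msg IP DATA) ← ξ .msgs
          some l.tail
        | v => fun ξ => ξ v)
    (enqueue IP DATA)

/-- The defining equations. -/
noncomputable def body : PName → SP IP DATA
  | .AODV => bodyAODV IP DATA
  | .PKT => bodyPKT IP DATA
  | .RREQ => bodyRREQ IP DATA
  | .RREP => bodyRREP IP DATA
  | .RERR => bodyRERR IP DATA
  | .QMSG => bodyQMSG IP DATA

end Processes

/-! ## Operational semantics -/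

variable {IP DATA : Type}

/-- The valuation `∅[varᵢ := ξ(expᵢ)]ᵢ` for a call of `X`. -/
def callValuation (X : PName) (args : (v : Var) → Exp IP DATA (v.Ty IP DATA))
    (ξ : Valuation IP DATA) : Valuation IP DATA :=
  fun v => if v ∈ X.params then args v ξ else none

/-- Transitions of sequential processes. A step that evaluates an expression is possible only if
the expression has a value. -/
inductive SeqStep : Valuation IP DATA → SP IP DATA → Act IP DATA →
    Valuation IP DATA → SP IP DATA → Prop
  | broadcast {ξ ms p m} (h : ms ξ = some m) :
      SeqStep ξ (.broadcast ms p) (.broadcast m) ξ p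
  | groupcast {ξ dests ms p D m} (hD : dests ξ = some D) (h : ms ξ = some m) :
      SeqStep ξ (.groupcast dests ms p) (.groupcast D m) ξ p
  | unicast {ξ dest ms p q d m} (hd : dest ξ = some d) (h : ms ξ = some m) :
      SeqStep ξ (.unicast dest ms p q) (.unicast d m) ξ p
  | notUnicast {ξ dest ms p q d} (hd : dest ξ = some d) :
      SeqStep ξ (.unicast dest ms p q) (.notUnicast d) ξ q
  | send {ξ ms p m} (h : ms ξ = some m) :
      SeqStep ξ (.send ms p) (.send m) ξ p
  | deliver {ξ data p d} (h : data ξ = some d) :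
      SeqStep ξ (.deliver data p) (.deliver d) ξ p
  | receive {ξ p} (m : Msg IP DATA) :
      SeqStep ξ (.receive p) (.receive m) (Function.update ξ .msg (some m)) p
  | assign {ξ v e p x} (h : e ξ = some x) :
      SeqStep ξ (.assign v e p) .tau (Function.update ξ v (some x)) p
  | call {ξ X args a ξ' p'} (hdef : ∀ v ∈ X.params, args v ξ ≠ none)
      (h : SeqStep (callValuation X args ξ) (body IP DATA X) a ξ' p') :
      SeqStep ξ (.call X args) a ξ' p'
  | choiceLeft {ξ p q a ξ' p'} (h : SeqStep ξ p a ξ' p') : SeqStep ξ (.choice p q) a ξ' p'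
  | choiceRight {ξ p q a ξ' q'} (h : SeqStep ξ q a ξ' q') : SeqStep ξ (.choice p q) a ξ' q'
  | guard {ξ φ p ξ'} (h : Extends φ ξ ξ') : SeqStep ξ (.guard φ p) .tau ξ' p

/-- Parallel process expressions, running on one node. -/
inductive PP (IP DATA : Type)
  | seq (ξ : Valuation IP DATA) (p : SP IP DATA)
  | par (P Q : PP IP DATA)

/-- Transitions of parallel processes: in `par P Q`, messages sent by `Q` are received by `P`. -/
inductive ParStep : PP IP DATA → Act IP DATA → PP IP DATA → Prop
  | seq {ξ p a ξ' p'} (h : SeqStep ξ p a ξ' p') : ParStep (.seq ξ p) a (.seq ξ' p')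
  | left {P Q a P'} (h : ParStep P a P') (ha : ∀ m, a ≠ .receive m) :
      ParStep (.par P Q) a (.par P' Q)
  | right {P Q a Q'} (h : ParStep Q a Q') (ha : ∀ m, a ≠ .send m) :
      ParStep (.par P Q) a (.par P Q')
  | comm {P Q m P' Q'} (hP : ParStep P (.receive m) P') (hQ : ParStep Q (.send m) Q') :
      ParStep (.par P Q) .tau (.par P' Q')

/-- Partial networks: parallel compositions of node expressions `ip : P : R`. -/
inductive PNet (IP DATA : Type)
  | node (ip : IP) (P : PP IP DATA) (R : Set IP)
  | par (M N : PNet IP DATA)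

/-- Complete networks `[M]`. -/
inductive Net (IP DATA : Type)
  | encap (M : PNet IP DATA)

/-- Transition labels of node and network expressions. `arrive H K m` says that `m` arrives at
the addresses in `H` and does not arrive at those in `K`. -/
inductive NAct (IP DATA : Type)
  | cast (R : Set IP) (m : Msg IP DATA)
  | arrive (H K : Set IP) (m : Msg IP DATA)
  | connect (ip ip' : IP)
  | disconnect (ip ip' : IP)
  | newpkt (ip : IP) (d : DATA) (dip : IP)
  | deliver (ip : IP) (d : DATA)
  | tau

/-- The two versions of the rules for topology changes: the ranges of nodes change independently
of each other, or `ip'` enters (leaves) the range of `ip` together with `ip` entering (leaving) the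
range of `ip'`. -/
inductive LinkMode
  | directed | symmetric

/-- The labels connect and disconnect. -/
def NAct.IsTopology : NAct IP DATA → Prop
  | .connect _ _ => True
  | .disconnect _ _ => True
  | _ => False

/-- The internal label and the delivery labels. -/
def NAct.IsLocal : NAct IP DATA → Prop
  | .deliver _ _ => True
  | .tau => True
  | _ => False

/-- Transitions of node expressions and partial networks. -/
inductive PNetStep (mode : LinkMode) : PNet IP DATA → NAct IP DATA → PNet IP DATA → Prop
  | broadcast {ip P P' R m} (h : ParStep P (.broadcast m) P') :
      PNetStep mode (.node ip P R) (.cast R m) (.node ip P' R)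
  | groupcast {ip P P' R D m} (h : ParStep P (.groupcast D m) P') :
      PNetStep mode (.node ip P R) (.cast (R ∩ D) m) (.node ip P' R)
  | unicast {ip P P' R dip m} (h : ParStep P (.unicast dip m) P') (hR : dip ∈ R) :
      PNetStep mode (.node ip P R) (.cast {dip} m) (.node ip P' R)
  | notUnicast {ip P P' R dip} (h : ParStep P (.notUnicast dip) P') (hR : dip ∉ R) :
      PNetStep mode (.node ip P R) .tau (.node ip P' R)
  | deliver {ip P P' R d} (h : ParStep P (.deliver d) P') :
      PNetStep mode (.node ip P R) (.deliver ip d) (.node ip P' R)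
  | receive {ip P P' R m} (h : ParStep P (.receive m) P') :
      PNetStep mode (.node ip P R) (.arrive {ip} ∅ m) (.node ip P' R)
  | tau {ip P P' R} (h : ParStep P .tau P') :
      PNetStep mode (.node ip P R) .tau (.node ip P' R)
  | ignore {ip P R} (m : Msg IP DATA) :
      PNetStep mode (.node ip P R) (.arrive ∅ {ip} m) (.node ip P R)
  | connect {ip P R} (ip' : IP) :
      PNetStep mode (.node ip P R) (.connect ip ip') (.node ip P (R ∪ {ip'}))
  | disconnect {ip P R} (ip' : IP) :
      PNetStep mode (.node ip P R) (.disconnect ip ip') (.node ip P (R \ {ip'}))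
  | connectRev {ip P R} (hm : mode = .symmetric) (ip' : IP) :
      PNetStep mode (.node ip P R) (.connect ip' ip) (.node ip P (R ∪ {ip'}))
  | disconnectRev {ip P R} (hm : mode = .symmetric) (ip' : IP) :
      PNetStep mode (.node ip P R) (.disconnect ip' ip) (.node ip P (R \ {ip'}))
  | connectOther {ip P R ip' ip''} (hm : mode = .symmetric) (h' : ip ≠ ip') (h'' : ip ≠ ip'') :
      PNetStep mode (.node ip P R) (.connect ip' ip'') (.node ip P R)
  | disconnectOther {ip P R ip' ip''} (hm : mode = .symmetric) (h' : ip ≠ ip') (h'' : ip ≠ ip'') :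
      PNetStep mode (.node ip P R) (.disconnect ip' ip'') (.node ip P R)
  | castLeft {M M' N N' R H K m} (hM : PNetStep mode M (.cast R m) M')
      (hN : PNetStep mode N (.arrive H K m) N') (hH : H ⊆ R) (hK : K ∩ R = ∅) :
      PNetStep mode (.par M N) (.cast R m) (.par M' N')
  | castRight {M M' N N' R H K m} (hM : PNetStep mode M (.cast R m) M')
      (hN : PNetStep mode N (.arrive H K m) N') (hH : H ⊆ R) (hK : K ∩ R = ∅) :
      PNetStep mode (.par N M) (.cast R m) (.par N' M')
  | arrive {M M' N N' H K H' K' m} (hM : PNetStep mode M (.arrive H K m) M')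
      (hN : PNetStep mode N (.arrive H' K' m) N') :
      PNetStep mode (.par M N) (.arrive (H ∪ H') (K ∪ K') m) (.par M' N')
  | left {M M' N a} (ha : a.IsLocal ∨ (mode = .directed ∧ a.IsTopology))
      (h : PNetStep mode M a M') : PNetStep mode (.par M N) a (.par M' N)
  | right {M N N' a} (ha : a.IsLocal ∨ (mode = .directed ∧ a.IsTopology))
      (h : PNetStep mode N a N') : PNetStep mode (.par M N) a (.par M N')
  | topology {M M' N N' a} (hm : mode = .symmetric) (ha : a.IsTopology)
      (hM : PNetStep mode M a M') (hN : PNetStep mode N a N') :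
      PNetStep mode (.par M N) a (.par M' N')

/-- Transitions of complete networks. -/
inductive NetStep (mode : LinkMode) : Net IP DATA → NAct IP DATA → Net IP DATA → Prop
  | cast {M M' R m} (h : PNetStep mode M (.cast R m) M') :
      NetStep mode (.encap M) .tau (.encap M')
  | newpkt {M M' ip K d dip} (h : PNetStep mode M (.arrive {ip} K (.newpkt d dip)) M') :
      NetStep mode (.encap M) (.newpkt ip d dip) (.encap M')
  | pass {M M' a} (ha : a.IsLocal ∨ a.IsTopology) (h : PNetStep mode M a M') :
      NetStep mode (.encap M) a (.encap M')

/-! ## Reachable networks -/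

/-- Initial valuation of the main process of node `ip`. -/
def initValuation (ip : IP) : Valuation IP DATA
  | .ip => some ip
  | .sn => some 1
  | .rt => some fun _ => none
  | .rreqs => some ∅
  | .queues => some fun _ => none
  | _ => none

/-- Initial valuation of the message queue. -/
def initQueue : Valuation IP DATA
  | .msgs => some []
  | _ => none

/-- Initial process of node `ip`. -/
def initProcess (ip : IP) : PP IP DATA :=
  .par (.seq (initValuation ip) (callSame IP DATA .AODV)) (.seq initQueue (callSame IP DATA .QMSG))

/-- Addresses of the nodes of a partial network. -/
def PNet.addresses : PNet IP DATA → List IP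
  | .node ip _ _ => [ip]
  | .par M N => M.addresses ++ N.addresses

/-- All nodes are in their initial state, with arbitrary ranges. -/
def PNet.AllInitial : PNet IP DATA → Prop
  | .node ip P _ => P = initProcess ip
  | .par M N => M.AllInitial ∧ N.AllInitial

/-- Initial network expressions: the nodes have distinct addresses and are all in their initial
state. -/
def Net.IsInitial : Net IP DATA → Prop
  | .encap M => M.addresses.Nodup ∧ M.AllInitial

/-- Reachable network expressions. -/
def Reachable (mode : LinkMode) (N : Net IP DATA) : Prop :=
  ∃ N₀ : Net IP DATA, N₀.IsInitial ∧
    Relation.ReflTransGen (fun N₁ N₂ => ∃ a, NetStep mode N₁ a N₂) N₀ N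

open Classical in
/-- The valuation `ξ` such that `ip : (ξ,* ⟪ *,*) : *` is a node expression of the network
(if there is one; addresses in reachable networks are distinct). -/
noncomputable def PNet.xi : PNet IP DATA → IP → Option (Valuation IP DATA)
  | .node ip' (.par (.seq ξ _) (.seq _ _)) _, ip => if ip' = ip then some ξ else none
  | .node _ _ _, _ => none
  | .par M N, ip => (M.xi ip).or (N.xi ip)

end AWN

/-! The property is local to one node: it depends only on the control flow of the process that sends
the reply, and nothing is assumed about received messages. No induction over the history of a route
is needed. A reply with the sender's address in its last field can come from three places. If the
destination answers, there is nothing to prove. If an intermediate node answers, sequence number and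
hop count are read off a table whose entry is known to be valid. If a node forwards a reply, the
data come from the received message; they agree with the table because the preceding update changed
it, and an update with a known sequence number and no precursors changes the table only by
installing the new entry (`hasRoute_update_of_ne`). Between these checks and the cast only
precursors are added (`HasRoute.addprecRT`).

To make this an invariant, `Safe` computes a verification condition by recursion on the syntax,
stopping at calls, where a precondition has to hold. `Safe.step` and `Safe.of_casts` show that it is
preserved and that it controls the messages cast. All code without replies is settled by the
syntactic criterion `ReplyFree`; `safe_bodyRREQ` and `safe_bodyRREP` treat the rest. At network
level, `PNet.Inv.exists_sender` traces a cast to a single node, and distinctness of addresses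
identifies its valuation with the one selected by `PNet.xi`. -/

namespace AWN

/-! ### Verification conditions for sequential processes -/

section VerificationConditions

variable {IP DATA : Type}

/-- Verification condition of a sequential process in a valuation: every message it casts, before
or after a call, satisfies `G` in the valuation at that moment, and every call satisfies `Q`. -/
def Safe (G : Valuation IP DATA → Msg IP DATA → Prop) (Q : PName → Valuation IP DATA → Prop) :
    SP IP DATA → Valuation IP DATA → Prop
  | .call X args, ξ => Q X (callValuation X args ξ)
  | .guard φ p, ξ => ∀ ξ', Extends φ ξ ξ' → Safe G Q p ξ'
  | .assign v e p, ξ => ∀ x, e ξ = some x → Safe G Q p (Function.update ξ v (some x))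
  | .choice p q, ξ => Safe G Q p ξ ∧ Safe G Q q ξ
  | .broadcast ms p, ξ => (∀ m, ms ξ = some m → G ξ m) ∧ Safe G Q p ξ
  | .groupcast _ ms p, ξ => (∀ m, ms ξ = some m → G ξ m) ∧ Safe G Q p ξ
  | .unicast _ ms p q, ξ => (∀ m, ms ξ = some m → G ξ m) ∧ Safe G Q p ξ ∧ Safe G Q q ξ
  | .send _ p, ξ => Safe G Q p ξ
  | .deliver _ p, ξ => Safe G Q p ξ
  | .receive p, ξ => ∀ m, Safe G Q p (Function.update ξ .msg (some m))

/-- `a.Casts m`: the action `a` broadcasts, groupcasts or unicasts `m`. -/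
def Act.Casts (a : Act IP DATA) (m : Msg IP DATA) : Prop :=
  a = .broadcast m ∨ (∃ D, a = .groupcast D m) ∨ ∃ d, a = .unicast d m

/-- The process cannot cast a message, or proceed by a call, in its first step. -/
def CastFreeStart : SP IP DATA → Prop
  | .choice p q => CastFreeStart p ∧ CastFreeStart q
  | .call _ _ => False
  | .broadcast _ _ => False
  | .groupcast _ _ _ => False
  | .unicast _ _ _ _ => False
  | _ => True

theorem CastFreeStart.not_casts {ξ ξ' : Valuation IP DATA} {p p' : SP IP DATA} {a : Act IP DATA}
    (h : SeqStep ξ p a ξ' p') (hp : CastFreeStart p) (m : Msg IP DATA) : ¬ a.Casts m := by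
  induction h with
  | choiceLeft _ ih => exact ih hp.1
  | choiceRight _ ih => exact ih hp.2
  | broadcast | groupcast | unicast | call => exact hp.elim
  | _ => simp [Act.Casts]

/-- A call and the first step of the body form one transition, so a cast made there would be judged
in the callee's valuation, while the network still shows the caller's. This cannot occur: every body
starts with guards, receptions or an assignment. -/
theorem castFreeStart_body (X : PName) : CastFreeStart (body IP DATA X) := by
  cases X <;>
    simp [body, bodyAODV, bodyPKT, bodyRREQ, bodyRREP, bodyRERR, bodyQMSG, enqueue, CastFreeStart]

variable {G : Valuation IP DATA → Msg IP DATA → Prop} {Q : PName → Valuation IP DATA → Prop}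

/-- This is the usual rule for recursive procedures: each body is verified once from its
precondition `Q`, and `hQ` is used exactly when a call is unfolded. -/
theorem Safe.step (hQ : ∀ X ξ, Q X ξ → Safe G Q (body IP DATA X) ξ)
    {ξ ξ' : Valuation IP DATA} {p p' : SP IP DATA} {a : Act IP DATA}
    (h : SeqStep ξ p a ξ' p') (hp : Safe G Q p ξ) : Safe G Q p' ξ' := by
  induction h with
  | broadcast => exact hp.2
  | groupcast => exact hp.2
  | unicast => exact hp.2.1
  | notUnicast => exact hp.2.2
  | send => exact hp
  | deliver => exact hp
  | receive m => exact hp m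
  | assign h => exact hp _ h
  | call _ _ ih => exact ih (hQ _ _ hp)
  | choiceLeft _ ih => exact ih hp.1
  | choiceRight _ ih => exact ih hp.2
  | guard h => exact hp _ h

/-- The valuation obtained is the one before the step. Nothing about `Q` is required, since a call
never casts in its first step. -/
theorem Safe.of_casts {ξ ξ' : Valuation IP DATA} {p p' : SP IP DATA} {a : Act IP DATA}
    (h : SeqStep ξ p a ξ' p') (hp : Safe G Q p ξ) {m : Msg IP DATA} (hm : a.Casts m) : G ξ m := by
  induction h with
  | broadcast h =>
    obtain rfl : _ = m := by simpa [Act.Casts] using hm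
    exact hp.1 _ h
  | groupcast _ h =>
    obtain rfl : _ = m := by simpa [Act.Casts] using hm
    exact hp.1 _ h
  | unicast _ h =>
    obtain rfl : _ = m := by simpa [Act.Casts] using hm
    exact hp.1 _ h
  | call _ h => exact ((castFreeStart_body _).not_casts h m hm).elim
  | choiceLeft _ ih => exact ih hp.1 hm
  | choiceRight _ ih => exact ih hp.2 hm
  | _ => simp [Act.Casts] at hm

end VerificationConditions

/-! ### Route replies and the routing table of their sender -/

section RouteReplies

variable {IP DATA : Type}

/-- The routing table `rt` has a valid entry for `dip` with sequence number `dsn` and hop count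
`hops`. -/
def HasRoute (rt : RT IP) (dip : IP) (dsn hops : ℕ) : Prop :=
  ∃ s, rt dip = some s ∧ s.dsn = dsn ∧ s.hops = hops ∧ s.flag = .val

/-- Only the precursor field of one entry changes. The destination `d` is arbitrary, so it does not
matter whether precursors are added to the entry for `dip` or to another one. -/
theorem HasRoute.addprecRT {rt rt' : RT IP} {dip d : IP} {dsn hops : ℕ} {npre : Set IP}
    (h : HasRoute rt dip dsn hops) (h' : addprecRT rt d npre = some rt') :
    HasRoute rt' dip dsn hops := by
  obtain ⟨s, hs, h1, h2, h3⟩ := h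
  simp only [AWN.addprecRT, Option.map_eq_some_iff] at h'
  obtain ⟨t, ht, rfl⟩ := h'
  by_cases hd : dip = d
  · subst hd
    obtain rfl : s = t := by simpa [hs] using ht
    exact ⟨_, if_pos rfl, h1, h2, h3⟩
  · exact ⟨s, by simp [hd, hs], h1, h2, h3⟩

/-- If an update with an entry with a known sequence number and no precursors changes the routing
table, then the new entry is installed. -/
theorem hasRoute_update_of_ne {rt : RT IP} {dip sip : IP} {dsn hops : ℕ}
    (h : rt ≠ update rt dip ⟨dsn, .kno, .val, hops, sip, ∅⟩) :
    HasRoute (update rt dip ⟨dsn, .kno, .val, hops, sip, ∅⟩) dip dsn hops := by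
  cases hs : rt dip with
  | none => exact ⟨⟨dsn, .kno, .val, hops, sip, ∅⟩, by simp [update, hs], rfl, rfl, rfl⟩
  | some s =>
    by_cases hc : s.dsn < dsn ∨ (s.dsn = dsn ∧ (s.flag = .inval ∨ hops < s.hops))
    · exact ⟨Entry.addPre ⟨dsn, .kno, .val, hops, sip, ∅⟩ s.pre, by simp [update, hs, hc],
        rfl, rfl, rfl⟩
    -- Without overwriting, the status `kno` excludes the branch for unknown sequence numbers, and
    -- the remaining branch only adds the empty set of precursors, so the table would not change.
    · refine absurd (funext fun d => ?_) h
      by_cases hd : d = dip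
      · subst hd
        simp [update, hs, hc, Entry.addPre]
      · simp [update, hd]

/-- A route reply carries the address of the node `ip` that sends it, and unless `ip` is the
destination, it describes a valid entry of the routing table of `ip`. -/
def ReplySound (ip : IP) (ξ : Valuation IP DATA) (m : Msg IP DATA) : Prop :=
  ∀ hops dip dsn oip sip, m = .rrep hops dip dsn oip sip →
    sip = ip ∧ (ip ≠ dip → ∃ rt, ξ .rt = some rt ∧ HasRoute rt dip dsn hops)

/-- Precondition of the process names used by the main process of node `ip`. -/
def MainCall (ip : IP) (X : PName) (ξ : Valuation IP DATA) : Prop :=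
  X ≠ .QMSG ∧ ξ .ip = some ip

/-- The process casts no route replies before its next call, does not change the variable `ip`,
and passes it on in calls of process names other than `QMSG`. -/
def ReplyFree : SP IP DATA → Prop
  | .call X args => X ≠ .QMSG ∧ ∀ ξ, args .ip ξ = ξ .ip
  | .guard _ p => ReplyFree p
  | .assign v _ p => v ≠ .ip ∧ ReplyFree p
  | .choice p q => ReplyFree p ∧ ReplyFree q
  | .broadcast ms p =>
    (∀ ξ hops dip dsn oip sip, ms ξ ≠ some (.rrep hops dip dsn oip sip)) ∧ ReplyFree p
  | .groupcast _ ms p =>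
    (∀ ξ hops dip dsn oip sip, ms ξ ≠ some (.rrep hops dip dsn oip sip)) ∧ ReplyFree p
  | .unicast _ ms p q =>
    (∀ ξ hops dip dsn oip sip, ms ξ ≠ some (.rrep hops dip dsn oip sip)) ∧
      ReplyFree p ∧ ReplyFree q
  | .send _ p => ReplyFree p
  | .deliver _ p => ReplyFree p
  | .receive p => ReplyFree p

theorem Extends.eq_some {φ : Formula IP DATA} {ξ ξ' : Valuation IP DATA} (h : Extends φ ξ ξ')
    {v : Var} {x : v.Ty IP DATA} (hx : ξ v = some x) : ξ' v = some x := by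
  rw [h.1 v (by simp [hx]), hx]

theorem update_apply_eq_some {ξ : Valuation IP DATA} {v w : Var} (hvw : v ≠ w)
    {x : v.Ty IP DATA} (hx : ξ v = some x) (y : Option (w.Ty IP DATA)) :
    Function.update ξ w y v = some x := by
  rw [Function.update_of_ne hvw, hx]

theorem mainCall_callValuation {ip : IP} {X : PName} (hX : X ≠ .QMSG)
    {args : (v : Var) → Exp IP DATA (v.Ty IP DATA)} {ξ : Valuation IP DATA}
    (h : args .ip ξ = some ip) : MainCall ip X (callValuation X args ξ) := by
  refine ⟨hX, ?_⟩
  have : Var.ip ∈ X.params := by cases X <;> simp_all [PName.params]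
  simp [callValuation, this, h]

/-- The only fact about the valuation to carry along is the value of `ip`: guards keep bound
variables, receptions write `msg`, and assignments avoid `ip`. This reduces most of the code to a
check that ignores valuations. -/
theorem ReplyFree.safe {ip : IP} {p : SP IP DATA} (hp : ReplyFree p) {ξ : Valuation IP DATA}
    (hξ : ξ .ip = some ip) : Safe (ReplySound ip) (MainCall ip) p ξ := by
  induction p generalizing ξ with
  | call X args => exact mainCall_callValuation hp.1 ((hp.2 ξ).trans hξ)
  | guard φ p ih => exact fun ξ' h => ih hp (h.eq_some hξ)
  | assign v e p ih => exact fun x _ => ih hp.2 (update_apply_eq_some hp.1.symm hξ _)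
  | choice p q ihp ihq => exact ⟨ihp hp.1 hξ, ihq hp.2 hξ⟩
  | broadcast ms p ih =>
    exact ⟨fun m hm _ _ _ _ _ e => (hp.1 _ _ _ _ _ _ (e ▸ hm)).elim, ih hp.2 hξ⟩
  | groupcast _ ms p ih =>
    exact ⟨fun m hm _ _ _ _ _ e => (hp.1 _ _ _ _ _ _ (e ▸ hm)).elim, ih hp.2 hξ⟩
  | unicast _ ms p q ihp ihq =>
    exact ⟨fun m hm _ _ _ _ _ e => (hp.1 _ _ _ _ _ _ (e ▸ hm)).elim, ihp hp.2.1 hξ,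
      ihq hp.2.2 hξ⟩
  | send _ p ih => exact ih hp hξ
  | deliver _ p ih => exact ih hp hξ
  | receive p ih => exact fun m => ih hp (update_apply_eq_some (by decide) hξ _)

theorem replyFree_callSame {X : PName} (hX : X ≠ .QMSG) : ReplyFree (callSame IP DATA X) :=
  ⟨hX, fun _ => rfl⟩

theorem replyFree_linkBreak (x : Exp IP DATA IP) : ReplyFree (linkBreak x) := by
  simp [linkBreak, ReplyFree, callSame, Option.bind_eq_some_iff]

theorem replyFree_bodyAODV : ReplyFree (bodyAODV IP DATA) := by
  simp [bodyAODV, updateNeighbour, ReplyFree, callSame, Option.bind_eq_some_iff,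
    replyFree_linkBreak]

theorem replyFree_bodyPKT : ReplyFree (bodyPKT IP DATA) := by
  simp [bodyPKT, ReplyFree, callSame, Option.bind_eq_some_iff, replyFree_linkBreak]

theorem replyFree_bodyRERR : ReplyFree (bodyRERR IP DATA) := by
  simp [bodyRERR, ReplyFree, callSame, Option.bind_eq_some_iff]

/-! ### The two bodies that send route replies -/

theorem safe_bodyRREQ {ip : IP} {ξ : Valuation IP DATA} (hξ : ξ .ip = some ip) :
    Safe (ReplySound ip) (MainCall ip) (bodyRREQ IP DATA) ξ := by
  have hA : ReplyFree (callSame IP DATA .AODV) := replyFree_callSame (by decide)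
  refine ⟨fun ξ₁ h₁ => hA.safe (h₁.eq_some hξ), fun ξ₁ h₁ rt₁ _ rreqs₁ _ => ?_⟩
  have hip := update_apply_eq_some (w := .rreqs) (by decide)
    (update_apply_eq_some (w := .rt) (by decide) (h₁.eq_some hξ) (some rt₁)) (some rreqs₁)
  -- From here on only the value of `ip` matters; the later guards supply everything else.
  generalize Function.update _ Var.rreqs _ = ξ₂ at hip ⊢
  refine ⟨fun ξ₃ h₃ sn _ => ?_, fun ξ₃ h₃ => ⟨fun ξ₄ h₄ rt₄ hrt₄ rt₅ hrt₅ => ?_, ?_⟩⟩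
  · have hip₃ := h₃.eq_some hip
    obtain ⟨d, i, hd, hi, rfl⟩ := h₃.2.2
    -- The destination itself answers, so the premise that sender and destination differ will be
    -- contradictory.
    obtain rfl : d = ip := by simpa [hi] using hip₃
    have hip₄ := update_apply_eq_some (w := .sn) (by decide) hip₃ (some sn)
    have hdip₄ := update_apply_eq_some (w := .sn) (by decide) hd (some sn)
    generalize Function.update _ Var.sn _ = ξ₄ at hip₄ hdip₄ ⊢
    refine ⟨?_, hA.safe hip₄, (replyFree_linkBreak _).safe hip₄⟩
    rintro m hm hops dip dsn oip sip rfl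
    simp only [hip₄, hdip₄, Option.bind_eq_bind, Option.bind_some, Option.bind_eq_some_iff,
      Option.some.injEq, Msg.rrep.injEq] at hm
    obtain ⟨_, _, _, _, _, rfl, _, _, rfl⟩ := hm
    exact ⟨rfl, fun h => (h rfl).elim⟩
  · have hip₄ := h₄.eq_some (h₃.eq_some hip)
    obtain ⟨d, _, rt, hd, _, hrt, ⟨s, hs, hval⟩, _, _⟩ := h₄.2.2
    have hr : HasRoute rt d s.dsn s.hops := ⟨s, hs, rfl, rfl, hval⟩
    simp only [hrt, hd, Option.bind_eq_bind, Option.bind_some, Option.bind_eq_some_iff] at hrt₄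
    obtain ⟨_, _, hrt₄⟩ := hrt₄
    replace hr := hr.addprecRT hrt₄
    have hip₅ := update_apply_eq_some (w := .rt) (by decide) hip₄ (some rt₄)
    have hd₅ := update_apply_eq_some (w := .rt) (by decide) hd (some rt₄)
    simp only [Function.update_self, hd₅, Option.bind_eq_bind, Option.bind_some,
      Option.bind_eq_some_iff] at hrt₅
    obtain ⟨_, _, _, _, hrt₅⟩ := hrt₅
    replace hr := hr.addprecRT hrt₅
    generalize Function.update _ Var.rt _ = ξ₅ at hip₅ hd₅ ⊢
    have hip₆ := update_apply_eq_some (w := .rt) (by decide) hip₅ (some rt₅)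
    have hd₆ := update_apply_eq_some (w := .rt) (by decide) hd₅ (some rt₅)
    have hrt₆ : Function.update ξ₅ Var.rt (some rt₅) Var.rt = some rt₅ := Function.update_self ..
    generalize Function.update _ Var.rt _ = ξ₆ at hip₆ hd₆ hrt₆ ⊢
    refine ⟨?_, hA.safe hip₆, (replyFree_linkBreak _).safe hip₆⟩
    rintro m hm hops dip dsn oip sip rfl
    simp only [hip₆, hd₆, hrt₆, Option.bind_eq_bind, Option.bind_some, Option.bind_eq_some_iff,
      Option.some.injEq, Msg.rrep.injEq] at hm
    obtain ⟨_, hh, _, _, rfl, rfl, rfl, _, rfl⟩ := hm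
    -- The reply evaluates sequence number and hop count in the final table `rt₅`, so only existence
    -- and validity of the entry had to survive the precursor additions.
    obtain ⟨t, ht, -, -, htv⟩ := hr
    refine ⟨rfl, fun _ => ⟨rt₅, hrt₆, t, ht, ?_, ?_, htv⟩⟩
    · simp [sqn, ht]
    · simpa [dhops, ht] using hh
  · refine ReplyFree.safe ?_ (h₃.eq_some hip)
    simp [ReplyFree, callSame, Option.bind_eq_some_iff]

/-- The forwarded reply repeats received data instead of reading the table. The agreement therefore
has to be established at the update and kept until the unicast, together with the values of `dip`,
`dsn` and `hops`. -/
theorem safe_bodyRREP {ip : IP} {ξ : Valuation IP DATA} (hξ : ξ .ip = some ip) :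
    Safe (ReplySound ip) (MainCall ip) (bodyRREP IP DATA) ξ := by
  have hA : ReplyFree (callSame IP DATA .AODV) := replyFree_callSame (by decide)
  refine ⟨fun ξ₁ h₁ rt₁ hrt₁ => ?_, fun ξ₁ h₁ => hA.safe (h₁.eq_some hξ)⟩
  have hip₁ := h₁.eq_some hξ
  obtain ⟨rt, d, sn, hops, sip, hrt, hd, hsn, hh, hsip, hne⟩ := h₁.2.2
  simp only [hrt, hd, hsn, hh, hsip, Option.bind_eq_bind, Option.bind_some,
    Option.some.injEq] at hrt₁
  subst hrt₁
  -- The guard says that the update changes the table; the entry installed has hop count `hops + 1`,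
  -- the one put into the forwarded reply.
  have hr := hasRoute_update_of_ne hne
  generalize update rt d _ = rt₂ at hr ⊢
  have hip₂ := update_apply_eq_some (w := .rt) (by decide) hip₁ (some rt₂)
  have hd₂ := update_apply_eq_some (w := .rt) (by decide) hd (some rt₂)
  have hsn₂ := update_apply_eq_some (w := .rt) (by decide) hsn (some rt₂)
  have hh₂ := update_apply_eq_some (w := .rt) (by decide) hh (some rt₂)
  have hrt₂ : Function.update ξ₁ Var.rt (some rt₂) Var.rt = some rt₂ := Function.update_self ..
  generalize Function.update _ Var.rt _ = ξ₂ at hip₂ hd₂ hsn₂ hh₂ hrt₂ ⊢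
  refine ⟨ReplyFree.safe (by simp [ReplyFree, callSame]) hip₂, fun ξ₃ h₃ =>
    ⟨fun ξ₄ h₄ rt₄ hrt₄ rt₅ hrt₅ => ?_, fun ξ₄ h₄ => hA.safe (h₄.eq_some (h₃.eq_some hip₂))⟩⟩
  have hip₄ := h₄.eq_some (h₃.eq_some hip₂)
  have hd₄ := h₄.eq_some (h₃.eq_some hd₂)
  have hsn₄ := h₄.eq_some (h₃.eq_some hsn₂)
  have hh₄ := h₄.eq_some (h₃.eq_some hh₂)
  simp only [h₄.eq_some (h₃.eq_some hrt₂), hd₄, Option.bind_eq_bind, Option.bind_some,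
    Option.bind_eq_some_iff] at hrt₄
  obtain ⟨_, _, _, _, hrt₄⟩ := hrt₄
  replace hr := hr.addprecRT hrt₄
  have hip₅ := update_apply_eq_some (w := .rt) (by decide) hip₄ (some rt₄)
  have hd₅ := update_apply_eq_some (w := .rt) (by decide) hd₄ (some rt₄)
  have hsn₅ := update_apply_eq_some (w := .rt) (by decide) hsn₄ (some rt₄)
  have hh₅ := update_apply_eq_some (w := .rt) (by decide) hh₄ (some rt₄)
  simp only [Function.update_self, hd₅, Option.bind_eq_bind, Option.bind_some,
    Option.bind_eq_some_iff] at hrt₅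
  obtain ⟨_, _, _, _, _, _, hrt₅⟩ := hrt₅
  replace hr := hr.addprecRT hrt₅
  generalize Function.update _ Var.rt _ = ξ₅ at hip₅ hd₅ hsn₅ hh₅ ⊢
  have hip₆ := update_apply_eq_some (w := .rt) (by decide) hip₅ (some rt₅)
  have hd₆ := update_apply_eq_some (w := .rt) (by decide) hd₅ (some rt₅)
  have hsn₆ := update_apply_eq_some (w := .rt) (by decide) hsn₅ (some rt₅)
  have hh₆ := update_apply_eq_some (w := .rt) (by decide) hh₅ (some rt₅)
  have hrt₆ : Function.update ξ₅ Var.rt (some rt₅) Var.rt = some rt₅ := Function.update_self ..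
  generalize Function.update _ Var.rt _ = ξ₆ at hip₆ hd₆ hsn₆ hh₆ hrt₆ ⊢
  refine ⟨?_, hA.safe hip₆, (replyFree_linkBreak _).safe hip₆⟩
  rintro m hm hops' dip dsn oip sip' rfl
  simp only [hip₆, hd₆, hsn₆, hh₆, Option.bind_eq_bind, Option.bind_some,
    Option.bind_eq_some_iff, Option.some.injEq, Msg.rrep.injEq] at hm
  obtain ⟨_, _, rfl, rfl, rfl, _, rfl⟩ := hm
  exact ⟨rfl, fun _ => ⟨rt₅, hrt₆, hr⟩⟩

theorem safe_body_of_mainCall {ip : IP} (X : PName) (ξ : Valuation IP DATA)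
    (h : MainCall ip X ξ) : Safe (ReplySound ip) (MainCall ip) (body IP DATA X) ξ := by
  cases X with
  | AODV => exact replyFree_bodyAODV.safe h.2
  | PKT => exact replyFree_bodyPKT.safe h.2
  | RREQ => exact safe_bodyRREQ h.2
  | RREP => exact safe_bodyRREP h.2
  | RERR => exact replyFree_bodyRERR.safe h.2
  | QMSG => exact (h.1 rfl).elim

/-- The message queue casts no messages. -/
theorem safe_body_of_queueCall (X : PName) (ξ : Valuation IP DATA) (h : X = .QMSG) :
    Safe (fun _ _ => False) (fun X _ => X = .QMSG) (body IP DATA X) ξ := by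
  subst h
  simp [body, bodyQMSG, enqueue, Safe]

end RouteReplies

/-! ### From processes to reachable networks -/

section Networks

variable {IP DATA : Type}

/-- The invariant of the process running on node `ip`: it consists of a main process and a message
queue, both satisfying their verification conditions. -/
def ProcessInv (ip : IP) (P : PP IP DATA) : Prop :=
  ∃ ξ p ζ q, P = .par (.seq ξ p) (.seq ζ q) ∧ Safe (ReplySound ip) (MainCall ip) p ξ ∧
    Safe (fun _ _ => False) (fun X _ => X = .QMSG) q ζ

theorem processInv_initProcess (ip : IP) : ProcessInv ip (initProcess ip : PP IP DATA) :=
  ⟨_, _, _, _, rfl, mainCall_callValuation (by decide) rfl, rfl⟩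

theorem ParStep.seqStep {ξ : Valuation IP DATA} {p : SP IP DATA} {a : Act IP DATA}
    {P' : PP IP DATA} (h : ParStep (.seq ξ p) a P') :
    ∃ ξ' p', P' = .seq ξ' p' ∧ SeqStep ξ p a ξ' p' := by
  cases h with
  | seq h => exact ⟨_, _, rfl, h⟩

/-- Both components are verified for every message they may receive, so a synchronisation needs no
relation between queue and main process. -/
theorem ProcessInv.step {ip : IP} {P P' : PP IP DATA} {a : Act IP DATA} (hP : ProcessInv ip P)
    (h : ParStep P a P') : ProcessInv ip P' := by
  obtain ⟨ξ, p, ζ, q, rfl, hp, hq⟩ := hP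
  cases h with
  | left h _ =>
    obtain ⟨_, _, rfl, hs⟩ := h.seqStep
    exact ⟨_, _, _, _, rfl, hp.step safe_body_of_mainCall hs, hq⟩
  | right h _ =>
    obtain ⟨_, _, rfl, hs⟩ := h.seqStep
    exact ⟨_, _, _, _, rfl, hp, hq.step safe_body_of_queueCall hs⟩
  | comm h h' =>
    obtain ⟨_, _, rfl, hs⟩ := h.seqStep
    obtain ⟨_, _, rfl, hs'⟩ := h'.seqStep
    exact ⟨_, _, _, _, rfl, hp.step safe_body_of_mainCall hs, hq.step safe_body_of_queueCall hs'⟩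

/-- A cast comes from the main process: the queue is verified with the guarantee `False`, and a
synchronisation is internal. -/
theorem ProcessInv.replySound {ip : IP} {P P' : PP IP DATA} {a : Act IP DATA}
    (hP : ProcessInv ip P) (h : ParStep P a P') {m : Msg IP DATA} (hm : a.Casts m) :
    ∃ ξ p ζ q, P = .par (.seq ξ p) (.seq ζ q) ∧ ReplySound ip ξ m := by
  obtain ⟨ξ, p, ζ, q, rfl, hp, hq⟩ := hP
  refine ⟨ξ, p, ζ, q, rfl, ?_⟩
  cases h with
  | left h _ =>
    obtain ⟨_, _, rfl, hs⟩ := h.seqStep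
    exact hp.of_casts hs hm
  | right h _ =>
    obtain ⟨_, _, rfl, hs⟩ := h.seqStep
    exact (hq.of_casts hs hm).elim
  | comm _ _ => simp [Act.Casts] at hm

/-- All nodes of the network satisfy the invariant. -/
def PNet.Inv : PNet IP DATA → Prop
  | .node ip P _ => ProcessInv ip P
  | .par M N => M.Inv ∧ N.Inv

theorem PNet.AllInitial.inv {M : PNet IP DATA} (h : M.AllInitial) : M.Inv := by
  induction M with
  | node ip P R =>
    obtain rfl : P = _ := h
    exact processInv_initProcess ip
  | par M N ihM ihN => exact ⟨ihM h.1, ihN h.2⟩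

variable {mode : LinkMode}

theorem PNet.Inv.step {M M' : PNet IP DATA} {a : NAct IP DATA} (hM : M.Inv)
    (h : PNetStep mode M a M') : M'.Inv := by
  induction h with
  | broadcast h | groupcast h | unicast h | notUnicast h | deliver h | receive h | tau h =>
    exact ProcessInv.step hM h
  | ignore | connect | disconnect | connectRev | disconnectRev | connectOther
  | disconnectOther => exact hM
  | castLeft _ _ _ _ ih₁ ih₂ => exact ⟨ih₁ hM.1, ih₂ hM.2⟩
  | castRight _ _ _ _ ih₁ ih₂ => exact ⟨ih₂ hM.1, ih₁ hM.2⟩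
  | arrive _ _ ih₁ ih₂ => exact ⟨ih₁ hM.1, ih₂ hM.2⟩
  | left _ _ ih => exact ⟨ih hM.1, hM.2⟩
  | right _ _ ih => exact ⟨hM.1, ih hM.2⟩
  | topology _ _ _ _ ih₁ ih₂ => exact ⟨ih₁ hM.1, ih₂ hM.2⟩

theorem PNetStep.addresses_eq {M M' : PNet IP DATA} {a : NAct IP DATA}
    (h : PNetStep mode M a M') : M'.addresses = M.addresses := by
  induction h <;> simp_all [PNet.addresses]

theorem Reachable.inv {M : PNet IP DATA} (h : Reachable mode (.encap M)) :
    M.addresses.Nodup ∧ M.Inv := by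
  obtain ⟨⟨M₀⟩, h₀, h⟩ := h
  suffices ∀ N, Relation.ReflTransGen (fun N₁ N₂ => ∃ a, NetStep mode N₁ a N₂) (.encap M₀) N →
      ∀ M : PNet IP DATA, N = .encap M → M.addresses.Nodup ∧ M.Inv from this _ h M rfl
  intro N hN
  induction hN with
  | refl =>
    rintro M ⟨⟩
    exact ⟨h₀.1, h₀.2.inv⟩
  | tail _ hs ih =>
    rintro M rfl
    obtain ⟨a, hs⟩ := hs
    cases hs with
    | cast h | newpkt h | pass _ h =>
      obtain ⟨hn, hi⟩ := ih _ rfl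
      exact ⟨h.addresses_eq ▸ hn, hi.step h⟩

theorem PNet.xi_eq_none {M : PNet IP DATA} {ip : IP} (h : ip ∉ M.addresses) : M.xi ip = none := by
  induction M with
  | node i P R =>
    have hi : i ≠ ip := fun e => h (by simp [PNet.addresses, e])
    unfold PNet.xi
    split <;> simp_all
  | par M N ihM ihN =>
    simp only [PNet.addresses, List.mem_append, not_or] at h
    simp [PNet.xi, ihM h.1, ihN h.2]

/-- Each cast label originates at one node and passes upwards through compositions whose other side
only lets the message arrive. -/
theorem PNet.Inv.exists_sender {M M' : PNet IP DATA} {R : Set IP} {m : Msg IP DATA}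
    (hinv : M.Inv) (hnd : M.addresses.Nodup) (h : PNetStep mode M (.cast R m) M') :
    ∃ ip ∈ M.addresses, ∃ ξ, M.xi ip = some ξ ∧ ReplySound ip ξ m := by
  generalize ha : NAct.cast R m = a at h
  have key {ip : IP} {P P' : PP IP DATA} {R : Set IP} {b : Act IP DATA}
      (hP : ProcessInv ip P) (h : ParStep P b P') (hb : b.Casts m) :
      ∃ i ∈ (PNet.node ip P R).addresses, ∃ ξ, (PNet.node ip P R).xi i = some ξ ∧
        ReplySound i ξ m := by
    obtain ⟨ξ, p, ζ, q, rfl, hs⟩ := hP.replySound h hb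
    exact ⟨ip, by simp [PNet.addresses], ξ, by simp [PNet.xi], hs⟩
  induction h with
  | broadcast h =>
    cases ha
    exact key hinv h (.inl rfl)
  | groupcast h =>
    cases ha
    exact key hinv h (.inr (.inl ⟨_, rfl⟩))
  | unicast h =>
    cases ha
    exact key hinv h (.inr (.inr ⟨_, rfl⟩))
  | castLeft _ _ _ _ ih =>
    cases ha
    obtain ⟨ip, hip, ξ, hξ, hs⟩ := ih hinv.1 (List.nodup_append.1 hnd).1 rfl
    exact ⟨ip, List.mem_append_left _ hip, ξ, by simp [PNet.xi, hξ], hs⟩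
  | castRight _ _ _ _ ih =>
    cases ha
    have hnd' := List.nodup_append.1 hnd
    obtain ⟨ip, hip, ξ, hξ, hs⟩ := ih hinv.2 hnd'.2.1 rfl
    -- `PNet.xi` searches the left component first; distinctness of addresses ensures that nothing
    -- is found there.
    refine ⟨ip, List.mem_append_right _ hip, ξ, ?_, hs⟩
    simp [PNet.xi, hξ, PNet.xi_eq_none fun h => hnd'.2.2 _ h _ hip rfl]
  -- Plain interleaving is restricted to local and topology labels, hence never yields a cast.
  | left hl | right hl =>
    subst ha
    simp [NAct.IsLocal, NAct.IsTopology] at hl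
  | topology _ ht =>
    subst ha
    exact ht.elim
  | _ => cases ha

end Networks

end AWN

/-- The transition is taken in the partial network `M` because encapsulation turns casts into
internal steps. -/
theorem proposition1 {IP DATA : Type} (mode : AWN.LinkMode) (M M' : AWN.PNet IP DATA)
    (hreach : AWN.Reachable mode (AWN.Net.encap M))
    (R : Set IP) (hops : ℕ) (dip : IP) (dsn : ℕ) (oip ip : IP) (hne : ip ≠ dip)
    (hcast : AWN.PNetStep mode M (AWN.NAct.cast R (AWN.Msg.rrep hops dip dsn oip ip)) M') :
    ∃ (ξ : AWN.Valuation IP DATA) (rt : AWN.RT IP),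
      M.xi ip = some ξ ∧ ξ AWN.Var.rt = some rt ∧
      dip ∈ AWN.kD rt ∧ AWN.sqn rt dip = dsn ∧ AWN.dhops rt dip = some hops ∧
      AWN.status rt dip = some AWN.Flag.val := by
  obtain ⟨hnd, hinv⟩ := hreach.inv
  obtain ⟨sip, -, ξ, hξ, hs⟩ := hinv.exists_sender hnd hcast
  -- The reply carries its sender's address, so the node found is the one named in the message.
  obtain ⟨rfl, hroute⟩ := hs _ _ _ _ _ rfl
  obtain ⟨rt, hrt, s, hsome, h1, h2, h3⟩ := hroute hne
  exact ⟨ξ, rt, hξ, hrt, ⟨s, hsome⟩, by simp [AWN.sqn, hsome, h1], by simp [AWN.dhops, hsome, h2],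
    by simp [AWN.status, hsome, h3]⟩
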